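/- Let $\mathbb G_\infty=(V,E)$ be an infinite, locally finite, connected graph, possibly with multiple edges and self-loops, and let $\mathbb G_t=(V,E_t)$, $t=0,1,2,\dots$, be subgraphs with $E_0\subseteq E_1\subseteq\cdots\subseteq E$. Let $V_t$ be the set of vertices joined by an edge of $E_t$ to some other vertex, and assume that for every $t$ the set $V_t$ is finite and the graph $\mathbb G_t$ restricted to $V_t$ is connected. For $x,y\in V_t$ let $\pi^{(t)}(x,y)$ be the number of edges of $E_t$ between $x$ and $y$ (with $\pi^{(t)}(x,x)$ the number of self-loops at $x$), and put $$\pi^{(t)}(x)=\sum_{y\in V_t}\pi^{(t)}(x,y),\qquad \pi^{(t)}(A)=\sum_{x\in A}\pi^{(t)}(x),\qquad \pi^{(t)}(A,B)=\sum_{x\in A,\,y\in B}\pi^{(t)}(x,y),\qquad v(t)=\pi^{(t)}(V_t),$$ $$\Phi_t=\inf\left\{\frac{\pi^{(t)}(A,V_t\setminus A)}{\pi^{(t)}(A)}:\ \emptyset\ne A\subseteq V_t,\ \pi^{(t)}(A)\le \frac{v(t)}{2}\right\}.$$ Let $x_0\in V_0$, and let $\{X_t\}_{t\ge0}$ be the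 simple random walk on $\{\mathbb G_t\}$ started at $X_0=x_0$, that is, the time-inhomogeneous Markov chain with $$P(t,x;t+1,y)=\mathbb P(X_{t+1}=y\mid X_t=x)=\frac{\pi^{(t)}(x,y)}{\pi^{(t)}(x)},\qquad x,y\in V_t.$$ **Proposition 1.6.** Assume that the walk is uniformly lazy, i.e. there is $\gamma\in(0,1/2]$ with $P(t,x;t+1,x)\ge\gamma$ for all $t\ge0$ and $x\in V_t$, and that the degrees are uniformly bounded, i.e. there is $\Delta<\infty$ with $\pi^{(t)}(x)\le\Delta$ for all $t\ge0$ and $x\in V_t$. If $$\sum_{t=1}^\infty \frac1{v(t)}<\infty\qquad\text{and}\qquad \sum_{t=1}^\infty\exp\Big\{-\sum_{u=\lfloor t/2\rfloor}^{t-1}\Phi_u^2\Big\}<\infty,$$ then $\{X_t\}$ is (strongly) transient: the expected number of visits to $x_0$ is finite, $\mathbb E_{x_0}\big[\sum_{t=0}^\infty \mathbf 1_{\{X_t=x_0\}}\big]<\infty$. -/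

import Mathlib

open MeasureTheory
open scoped ENNReal

noncomputable section

namespace GrowingWalk

variable {V E Ω : Type*}

/-! ### Quantities attached to one multigraph -/

/-- The set of non-isolated vertices: those joined by an edge to some *other* vertex. -/
def nonIsolated (G : Graph V E) : Set V :=
  {x | ∃ y, y ≠ x ∧ G.Adj x y}

/-- `π(x, y)`: the number of edges between `x` and `y`; `π(x, x)` counts the self-loops at `x`. -/
def edgeCount (G : Graph V E) (x y : V) : ℝ :=
  ({e : E | G.IsLink e x y}.ncard : ℝ)

/-- `π(A, B) = ∑_{x ∈ A, y ∈ B} π(x, y)`. -/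
def flow (G : Graph V E) (A B : Set V) : ℝ :=
  ∑ᶠ x ∈ A, ∑ᶠ y ∈ B, edgeCount G x y

/-- The degree `π(x)`, the sum of `π(x, y)` over the non-isolated vertices `y`. -/
def degree (G : Graph V E) (x : V) : ℝ :=
  ∑ᶠ y ∈ nonIsolated G, edgeCount G x y

/-- `π(A) = ∑_{x ∈ A} π(x)`. -/
def degreeSum (G : Graph V E) (A : Set V) : ℝ :=
  ∑ᶠ x ∈ A, degree G x

/-- The volume of the graph: the sum of the degrees of all non-isolated vertices. -/
def vol (G : Graph V E) : ℝ :=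
  degreeSum G (nonIsolated G)

/-- The isoperimetric function `φ(r)`: the infimum of `π(A, Aᶜ) / π(A)` over the nonempty sets `A`
of non-isolated vertices with `π(A) ≤ (v / 2) ∧ r`, where `v` is the volume and the complement is
taken among the non-isolated vertices. The infimum of the empty family is `∞`. -/
def isoperimetric (G : Graph V E) (r : ℝ) : ℝ≥0∞ :=
  ⨅ (A : Set V) (_ : A ⊆ nonIsolated G ∧ A.Nonempty ∧ degreeSum G A ≤ min (vol G / 2) r),
    ENNReal.ofReal (flow G A (nonIsolated G \ A) / degreeSum G A)

/-- The Cheeger constant `Φ = φ(v / 2)`. If the set of non-isolated vertices is finite and nonempty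
it has at least two elements, one of which has degree at most `v / 2`, so `φ(v / 2)` is finite and
taking the real value loses nothing. -/
def cheeger (G : Graph V E) : ℝ :=
  (isoperimetric G (vol G / 2)).toReal

/-- One-step transition probability `π(x, y) / π(x)` of simple random walk. -/
def stepProb (G : Graph V E) (x y : V) : ℝ :=
  edgeCount G x y / degree G x

/-- Any two vertices of `S` are joined by a path of `G`. -/
def ConnectedOn (G : Graph V E) (S : Set V) : Prop :=
  ∀ x ∈ S, ∀ y ∈ S, Relation.ReflTransGen G.Adj x y

/-! ### Growing sequences of graphs -/

/-- `G 0 ≤ G 1 ≤ ...` is an increasing sequence of subgraphs of the infinite, locally finite,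
connected multigraph `Ginf`, all on the same vertex set; the non-isolated part of each `G t` is
finite and connected. -/
structure IsGrowing (Ginf : Graph V E) (G : ℕ → Graph V E) : Prop where
  infinite : Ginf.vertexSet.Infinite
  locallyFinite : ∀ x ∈ Ginf.vertexSet, {e : E | Ginf.Inc e x}.Finite
  connected : ConnectedOn Ginf Ginf.vertexSet
  spanning : ∀ t, (G t).IsSpanningSubgraph Ginf
  mono : ∀ t, G t ≤ G (t + 1)
  finite_nonIsolated : ∀ t, (nonIsolated (G t)).Finite
  connected_nonIsolated : ∀ t, ConnectedOn (G t) (nonIsolated (G t))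

/-- The walk is uniformly lazy: it stays put with probability at least some fixed
`γ ∈ (0, 1/2]`, at all times and at all non-isolated vertices. -/
def UniformlyLazy (G : ℕ → Graph V E) : Prop :=
  ∃ γ : ℝ, 0 < γ ∧ γ ≤ 1 / 2 ∧ ∀ t, ∀ x ∈ nonIsolated (G t), γ ≤ stepProb (G t) x x

/-- The degrees are bounded uniformly in time and space. -/
def UniformlyBoundedDegrees (G : ℕ → Graph V E) : Prop :=
  ∃ Δ : ℝ, ∀ t, ∀ x ∈ nonIsolated (G t), degree (G t) x ≤ Δ

/-! ### The random walk -/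

/-- `X` is simple random walk on the sequence `G` started at `x₀`: the time-inhomogeneous Markov
chain whose step from time `t` to time `t + 1` has the transition probabilities of `G t`. -/
structure IsSimpleRandomWalk [MeasurableSpace V] [MeasurableSpace Ω] (G : ℕ → Graph V E) (x₀ : V)
    (μ : Measure Ω) (X : ℕ → Ω → V) : Prop where
  measurable : ∀ t, Measurable (X t)
  start : ∀ᵐ ω ∂μ, X 0 ω = x₀
  step : ∀ (t : ℕ) (x : ℕ → V),
    μ {ω | ∀ i ≤ t + 1, X i ω = x i} =
      μ {ω | ∀ i ≤ t, X i ω = x i} * ENNReal.ofReal (stepProb (G t) (x t) (x (t + 1)))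

/-- The number of visits `N₀ = ∑_{t ≥ 0} 1_{X_t = x₀}` to `x₀`. -/
def visits (X : ℕ → Ω → V) (x₀ : V) (ω : Ω) : ℝ≥0∞ :=
  ∑' t : ℕ, Set.indicator {ω' | X t ω' = x₀} (fun _ => (1 : ℝ≥0∞)) ω

/-- Strong transience: the expected number of visits to the starting point is finite. -/
def StronglyTransient [MeasurableSpace Ω] (μ : Measure Ω) (X : ℕ → Ω → V) (x₀ : V) : Prop :=
  ∫⁻ ω, visits X x₀ ω ∂μ < ∞

end GrowingWalk

end

/-! By Tonelli the expected number of visits is the sum of the probabilities `P(X_t = x₀)`, so a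
summable heat kernel bound suffices. Split at a time `s`: `P(X_t = x₀) = ∑ q_s(x) K(x)`, where `q_s`
is the law at time `s` and `K(x)` the probability of going from `x` at time `s` to `x₀` at time `t`.
By AM-GM this is at most `∑ q_s² / π_s + ∑ π_s K²`. Growth of the graph helps both sums: the first
is followed forward in time with degrees in the denominator, the second backward with degrees in the
numerator.

Each step of the walk contracts these sums by `exp(-γ Φ²)` towards a level of order `1 / v`
(`sum_netAvg_sq_le`). Cheeger's argument gives a Poincaré inequality, and laziness turns the
Dirichlet form into a loss of `ℓ²` norm. The levels stay controlled because the law has mass one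
and, by reversibility and the degree bound, `∑ π_s K ≤ Δ`. The outcome is `law_le`.

The exponent there contains `γ`, but the one in the hypothesis does not. This is repaired by running
the contraction over `M ≥ 1 / γ` successive halvings of `t` and applying Jensen's inequality to the
exponential (`summable_exp_neg_mul_sum`). -/

namespace GrowingWalk

section FiniteNetwork

/-! ### Cheeger inequality and variance decay on a finite weighted graph -/

variable {V : Type*} {W : Finset V} {w : V → V → ℝ}

/-- A discrete co-area inequality. -/
theorem two_mul_sum_le_sum_abs_sub [DecidableEq V] (hw : ∀ x y, 0 ≤ w x y) (hsymm : ∀ x y, w x y = w y x)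
    {d : V → ℝ} (hd : ∀ x, 0 ≤ d x) {κ b : ℝ}
    (hκ : ∀ A ⊆ W, A.Nonempty → ∑ x ∈ A, d x ≤ b →
      κ * ∑ x ∈ A, d x ≤ ∑ x ∈ A, ∑ y ∈ W \ A, w x y)
    (F : V → ℝ) (hF : ∀ x, 0 ≤ F x) (hb : ∑ x ∈ W with 0 < F x, d x ≤ b) :
    2 * κ * ∑ x ∈ W, d x * F x ≤ ∑ x ∈ W, ∑ y ∈ W, w x y * |F x - F y| := by
  induction hn : (W.filter (fun x => 0 < F x)).card using Nat.strong_induction_on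
    generalizing F with
  | _ n ih =>
  set A := W.filter (fun x => 0 < F x) with hA
  have hout : ∀ x ∈ W, x ∉ A → F x = 0 := fun x hx hxA =>
    le_antisymm (not_lt.1 fun h => hxA (Finset.mem_filter.2 ⟨hx, h⟩)) (hF x)
  rcases A.eq_empty_or_nonempty with hAe | hAne
  · have h0 : ∑ x ∈ W, d x * F x = 0 :=
      Finset.sum_eq_zero fun x hx => by rw [hout x hx (by simp [hAe]), mul_zero]
    rw [h0, mul_zero]
    exact Finset.sum_nonneg fun x _ => Finset.sum_nonneg fun y _ =>
      mul_nonneg (hw x y) (abs_nonneg _)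
  obtain ⟨z, hzA, hz⟩ := A.exists_min_image F hAne
  set m := F z with hm
  have hmpos : 0 < m := (Finset.mem_filter.1 hzA).2
  -- Peel off the lowest layer `m · 1_A` of `F`. The minimiser `z` leaves the support, which drives
  -- the induction.
  set F' : V → ℝ := fun x => if x ∈ A then F x - m else F x with hF'
  have hF'0 : ∀ x, 0 ≤ F' x := by
    intro x
    simp only [hF']
    split_ifs with h
    · exact sub_nonneg.2 (hz x h)
    · exact hF x
  have hsub : (W.filter fun x => 0 < F' x) ⊆ A := by
    intro x hx
    obtain ⟨hxW, hx0⟩ := Finset.mem_filter.1 hx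
    by_contra hxA
    simp only [hF', if_neg hxA, hout x hxW hxA, lt_irrefl] at hx0
  have hlt : (W.filter fun x => 0 < F' x).card < n := by
    rw [← hn]
    refine Finset.card_lt_card ⟨hsub, fun h => ?_⟩
    have := (Finset.mem_filter.1 (h hzA)).2
    simp [hF', hzA, hm] at this
  have key := ih _ hlt F' hF'0
    ((Finset.sum_le_sum_of_subset_of_nonneg hsub fun x _ _ => hd x).trans hb) rfl
  have hAW : A ⊆ W := Finset.filter_subset _ _
  have hcut := hκ A hAW hAne hb
  have hsum : ∑ x ∈ W, d x * F x = m * ∑ x ∈ A, d x + ∑ x ∈ W, d x * F' x := by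
    have : ∑ x ∈ A, d x = ∑ x ∈ W, if x ∈ A then d x else 0 := by
      rw [← Finset.sum_filter, Finset.filter_mem_eq_inter, Finset.inter_eq_right.2 hAW]
    rw [this, Finset.mul_sum, ← Finset.sum_add_distrib]
    refine Finset.sum_congr rfl fun x _ => ?_
    simp only [hF']
    split_ifs <;> ring
  have hcross : ∑ x ∈ A, ∑ y ∈ W \ A, w x y
      = ∑ x ∈ W, ∑ y ∈ W, if x ∈ A ∧ y ∉ A then w x y else 0 := by
    rw [← Finset.sum_subset hAW]
    · refine Finset.sum_congr rfl fun x hx => ?_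
      simp only [hx, true_and]
      rw [← Finset.sum_filter, Finset.filter_notMem_eq_sdiff]
    · intro x _ hx
      simp [hx]
  have hcross' : ∑ x ∈ A, ∑ y ∈ W \ A, w x y
      = ∑ x ∈ W, ∑ y ∈ W, if y ∈ A ∧ x ∉ A then w x y else 0 := by
    rw [hcross, Finset.sum_comm]
    simp only [hsymm]
  -- Only pairs with exactly one endpoint in `A` lose `m`, and each occurs in both orders: hence the
  -- factor 2.
  have habs : ∑ x ∈ W, ∑ y ∈ W, w x y * |F x - F y|
      = m * (2 * ∑ x ∈ A, ∑ y ∈ W \ A, w x y) + ∑ x ∈ W, ∑ y ∈ W, w x y * |F' x - F' y| := by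
    rw [two_mul]
    nth_rw 1 [hcross]
    rw [hcross', ← Finset.sum_add_distrib, Finset.mul_sum, ← Finset.sum_add_distrib]
    refine Finset.sum_congr rfl fun x hx => ?_
    rw [← Finset.sum_add_distrib, Finset.mul_sum, ← Finset.sum_add_distrib]
    refine Finset.sum_congr rfl fun y hy => ?_
    by_cases hxA : x ∈ A <;> by_cases hyA : y ∈ A <;> simp only [hF', hxA, hyA] <;> simp
    · rw [hout y hy hyA, sub_zero, sub_zero, abs_of_nonneg (hF x),
        abs_of_nonneg (sub_nonneg.2 (hz x hxA))]
      ring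
    · rw [hout x hx hxA, zero_sub, zero_sub, abs_neg, abs_neg, abs_of_nonneg (hF y),
        abs_of_nonneg (sub_nonneg.2 (hz y hyA))]
      ring
  rw [hsum, habs]
  nlinarith [mul_le_mul_of_nonneg_left hcut hmpos.le]

/-- The weighted degree of a vertex in the finite network `w` on `W`. -/
def netDeg (W : Finset V) (w : V → V → ℝ) (x : V) : ℝ := ∑ y ∈ W, w x y

theorem sum_netDeg_mul (W : Finset V) (w : V → V → ℝ) (f : V → ℝ) :
    ∑ x ∈ W, ∑ y ∈ W, w x y * f x = ∑ x ∈ W, netDeg W w x * f x := by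
  simp only [netDeg, Finset.sum_mul]

theorem sum_netDeg_mul_right (hsymm : ∀ x y, w x y = w y x) (f : V → ℝ) :
    ∑ x ∈ W, ∑ y ∈ W, w x y * f y = ∑ x ∈ W, netDeg W w x * f x := by
  rw [Finset.sum_comm, ← sum_netDeg_mul]
  simp only [hsymm]

theorem netDeg_nonneg (hw : ∀ x y, 0 ≤ w x y) (x : V) : 0 ≤ netDeg W w x :=
  Finset.sum_nonneg fun y _ => hw x y

/-- `κ` bounds from below the conductance of all nonempty sets of at most half the volume. -/
def HasConductance [DecidableEq V] (W : Finset V) (w : V → V → ℝ) (κ : ℝ) : Prop :=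
  ∀ A ⊆ W, A.Nonempty → ∑ x ∈ A, netDeg W w x ≤ (∑ x ∈ W, netDeg W w x) / 2 →
    κ * ∑ x ∈ A, netDeg W w x ≤ ∑ x ∈ A, ∑ y ∈ W \ A, w x y

/-- Apply the co-area inequality to `F²`, factor `F x ² - F y ²` and use Cauchy–Schwarz; the factor
`∑ w (F x + F y)²` is at most four times the left-hand sum, which then cancels. -/
theorem sq_mul_sum_sq_le_dirichlet [DecidableEq V] (hw : ∀ x y, 0 ≤ w x y) (hsymm : ∀ x y, w x y = w y x)
    {κ : ℝ} (hκ0 : 0 ≤ κ) (hκ : HasConductance W w κ) {F : V → ℝ} (hF : ∀ x, 0 ≤ F x)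
    (hb : ∑ x ∈ W with 0 < F x, netDeg W w x ≤ (∑ x ∈ W, netDeg W w x) / 2) :
    κ ^ 2 * ∑ x ∈ W, netDeg W w x * F x ^ 2 ≤ ∑ x ∈ W, ∑ y ∈ W, w x y * (F x - F y) ^ 2 := by
  set S := ∑ x ∈ W, netDeg W w x * F x ^ 2 with hS
  set D := ∑ x ∈ W, ∑ y ∈ W, w x y * (F x - F y) ^ 2 with hD
  have hS0 : 0 ≤ S := Finset.sum_nonneg fun x _ => mul_nonneg (netDeg_nonneg hw x) (sq_nonneg _)
  have hD0 : 0 ≤ D := Finset.sum_nonneg fun x _ => Finset.sum_nonneg fun y _ =>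
    mul_nonneg (hw x y) (sq_nonneg _)
  have hpos : ∀ x, 0 < F x ^ 2 ↔ 0 < F x := fun x =>
    ⟨fun h => (hF x).lt_of_ne fun h0 => by simp [← h0] at h, fun h => by positivity⟩
  have hco := two_mul_sum_le_sum_abs_sub hw hsymm (netDeg_nonneg (W := W) hw) hκ
    (fun x => F x ^ 2) (fun x => sq_nonneg _) (by simpa only [hpos] using hb)
  set T := ∑ x ∈ W, ∑ y ∈ W, w x y * |F x ^ 2 - F y ^ 2| with hT
  have hR : ∑ x ∈ W, ∑ y ∈ W, w x y * (F x + F y) ^ 2 ≤ 4 * S := by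
    have : 4 * S = ∑ x ∈ W, ∑ y ∈ W, (2 * (w x y * F x ^ 2) + 2 * (w x y * F y ^ 2)) := by
      simp only [Finset.sum_add_distrib, ← Finset.mul_sum]
      rw [sum_netDeg_mul W w fun x => F x ^ 2, sum_netDeg_mul_right hsymm fun x => F x ^ 2]
      ring
    rw [this]
    refine Finset.sum_le_sum fun x _ => Finset.sum_le_sum fun y _ => ?_
    nlinarith [mul_nonneg (hw x y) (sq_nonneg (F x - F y))]
  have hCS : T ^ 2 ≤ D * ∑ x ∈ W, ∑ y ∈ W, w x y * (F x + F y) ^ 2 := by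
    rw [hT, hD, ← Finset.sum_product', ← Finset.sum_product', ← Finset.sum_product']
    refine Finset.sum_sq_le_sum_mul_sum_of_sq_le_mul _
      (fun p _ => mul_nonneg (hw _ _) (sq_nonneg _))
      (fun p _ => mul_nonneg (hw _ _) (sq_nonneg _)) fun p _ => le_of_eq ?_
    rw [mul_pow, sq_abs]
    ring
  have h1 : (2 * κ * S) ^ 2 ≤ D * (4 * S) :=
    (pow_le_pow_left₀ (by positivity) hco 2).trans (hCS.trans (mul_le_mul_of_nonneg_left hR hD0))
  rcases hS0.eq_or_lt with h | h
  · rw [← h, mul_zero]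
    exact hD0
  · refine le_of_mul_le_mul_right (a := 4 * S) ?_ (by positivity)
    nlinarith

/-- A weighted median. -/
theorem exists_median {d : V → ℝ} (hd : ∀ x, 0 ≤ d x) (hW : W.Nonempty) (f : V → ℝ) :
    ∃ c, ∑ x ∈ W with c < f x, d x ≤ (∑ x ∈ W, d x) / 2 ∧
      ∑ x ∈ W with f x < c, d x ≤ (∑ x ∈ W, d x) / 2 := by
  have hv : 0 ≤ ∑ x ∈ W, d x := Finset.sum_nonneg fun x _ => hd x
  -- The median is the least value above which lies at most half the mass. For the next lower value
  -- `f u` this fails, and `{f < f z}` is the complement of `{f > f u}`.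
  set B := W.filter fun z => ∑ x ∈ W with f z < f x, d x ≤ (∑ x ∈ W, d x) / 2 with hB
  have hBne : B.Nonempty := by
    obtain ⟨z, hz, hmax⟩ := W.exists_max_image f hW
    refine ⟨z, Finset.mem_filter.2 ⟨hz, ?_⟩⟩
    rw [Finset.filter_false_of_mem fun x hx => not_lt.2 (hmax x hx), Finset.sum_empty]
    positivity
  obtain ⟨z, hzB, hmin⟩ := B.exists_min_image f hBne
  refine ⟨f z, (Finset.mem_filter.1 hzB).2, ?_⟩
  rcases (W.filter fun x => f x < f z).eq_empty_or_nonempty with he | hne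
  · rw [he, Finset.sum_empty]
    positivity
  obtain ⟨u, hu, humax⟩ := Finset.exists_max_image _ f hne
  obtain ⟨huW, huz⟩ := Finset.mem_filter.1 hu
  have huB : (∑ x ∈ W, d x) / 2 < ∑ x ∈ W with f u < f x, d x := by
    by_contra h
    exact absurd (hmin u (Finset.mem_filter.2 ⟨huW, not_lt.1 h⟩)) (not_le.2 huz)
  have hsplit := Finset.sum_filter_add_sum_filter_not W (fun x => f x < f z) d
  have heq : (W.filter fun x => ¬ f x < f z) = W.filter fun x => f u < f x := by
    refine Finset.filter_congr fun x hx => ⟨fun h => huz.trans_le (not_lt.1 h), fun h h' => ?_⟩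
    exact absurd (humax x (Finset.mem_filter.2 ⟨hx, h'⟩)) (not_le.2 h)
  rw [heq] at hsplit
  linarith

/-- Poincaré inequality, with the constant given by Cheeger's inequality. -/
theorem poincare [DecidableEq V] (hw : ∀ x y, 0 ≤ w x y) (hsymm : ∀ x y, w x y = w y x)
    {κ : ℝ} (hκ0 : 0 ≤ κ) (hκ : HasConductance W w κ) (hv : 0 < ∑ x ∈ W, netDeg W w x)
    (f : V → ℝ) :
    κ ^ 2 * (∑ x ∈ W, netDeg W w x * f x ^ 2 -
        (∑ x ∈ W, netDeg W w x * f x) ^ 2 / ∑ x ∈ W, netDeg W w x) ≤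
      ∑ x ∈ W, ∑ y ∈ W, w x y * (f x - f y) ^ 2 := by
  have hW : W.Nonempty := Finset.nonempty_iff_ne_empty.2 fun h => by simp [h] at hv
  obtain ⟨c, hc1, hc2⟩ := exists_median (netDeg_nonneg (W := W) hw) hW f
  -- Centring at a median makes the supports of both the positive and the negative part of `f - c`
  -- admissible for the conductance bound.
  have h1 := sq_mul_sum_sq_le_dirichlet hw hsymm hκ0 hκ (F := fun x => max (f x - c) 0)
    (fun x => le_max_right _ _) (by simpa using hc1)
  have h2 := sq_mul_sum_sq_le_dirichlet hw hsymm hκ0 hκ (F := fun x => max (c - f x) 0)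
    (fun x => le_max_right _ _) (by simpa using hc2)
  have h3 : ∑ x ∈ W, ∑ y ∈ W, w x y * (max (f x - c) 0 - max (f y - c) 0) ^ 2 +
      ∑ x ∈ W, ∑ y ∈ W, w x y * (max (c - f x) 0 - max (c - f y) 0) ^ 2 ≤
      ∑ x ∈ W, ∑ y ∈ W, w x y * (f x - f y) ^ 2 := by
    rw [← Finset.sum_add_distrib]
    refine Finset.sum_le_sum fun x _ => ?_
    rw [← Finset.sum_add_distrib]
    refine Finset.sum_le_sum fun y _ => ?_
    rw [← mul_add]
    refine mul_le_mul_of_nonneg_left ?_ (hw x y)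
    rcases le_total (f x) c with hx | hx <;> rcases le_total (f y) c with hy | hy
    · rw [max_eq_right (sub_nonpos.2 hx), max_eq_right (sub_nonpos.2 hy),
        max_eq_left (sub_nonneg.2 hx), max_eq_left (sub_nonneg.2 hy)]
      exact le_of_eq (by ring)
    · rw [max_eq_right (sub_nonpos.2 hx), max_eq_left (sub_nonneg.2 hy),
        max_eq_left (sub_nonneg.2 hx), max_eq_right (sub_nonpos.2 hy)]
      nlinarith [mul_nonneg (sub_nonneg.2 hx) (sub_nonneg.2 hy)]
    · rw [max_eq_left (sub_nonneg.2 hx), max_eq_right (sub_nonpos.2 hy),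
        max_eq_right (sub_nonpos.2 hx), max_eq_left (sub_nonneg.2 hy)]
      nlinarith [mul_nonneg (sub_nonneg.2 hx) (sub_nonneg.2 hy)]
    · rw [max_eq_left (sub_nonneg.2 hx), max_eq_left (sub_nonneg.2 hy),
        max_eq_right (sub_nonpos.2 hx), max_eq_right (sub_nonpos.2 hy)]
      exact le_of_eq (by ring)
  have h4 : ∑ x ∈ W, netDeg W w x * max (f x - c) 0 ^ 2 +
      ∑ x ∈ W, netDeg W w x * max (c - f x) 0 ^ 2 =
      ∑ x ∈ W, netDeg W w x * f x ^ 2 - 2 * c * ∑ x ∈ W, netDeg W w x * f x +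
        c ^ 2 * ∑ x ∈ W, netDeg W w x := by
    rw [Finset.mul_sum, Finset.mul_sum, ← Finset.sum_add_distrib, ← Finset.sum_sub_distrib,
      ← Finset.sum_add_distrib]
    refine Finset.sum_congr rfl fun x _ => ?_
    rcases le_total (f x) c with hx | hx
    · rw [max_eq_right (sub_nonpos.2 hx), max_eq_left (sub_nonneg.2 hx)]
      ring
    · rw [max_eq_left (sub_nonneg.2 hx), max_eq_right (sub_nonpos.2 hx)]
      ring
  set v := ∑ x ∈ W, netDeg W w x
  set m := ∑ x ∈ W, netDeg W w x * f x
  set S := ∑ x ∈ W, netDeg W w x * f x ^ 2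
  -- The second moment about any `c` is at least the one about the mean `m / v`.
  have h5 : S - m ^ 2 / v ≤ S - 2 * c * m + c ^ 2 * v := by
    have : S - 2 * c * m + c ^ 2 * v - (S - m ^ 2 / v) = (m - c * v) ^ 2 / v := by
      field_simp
      ring
    have h0 : 0 ≤ (m - c * v) ^ 2 / v := by positivity
    linarith
  calc κ ^ 2 * (S - m ^ 2 / v) ≤ κ ^ 2 * (S - 2 * c * m + c ^ 2 * v) :=
        mul_le_mul_of_nonneg_left h5 (sq_nonneg κ)
    _ ≤ _ := by rw [← h4, mul_add]; linarith

/-- The averaging operator of simple random walk on the network. -/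
noncomputable def netAvg (W : Finset V) (w : V → V → ℝ) (f : V → ℝ) (x : V) : ℝ :=
  (∑ y ∈ W, w x y * f y) / netDeg W w x

/-- With `Q = ∑ w (f x - f y)²` and `L = ∑ w (f y - f x)`, the local variance is `Q - L² / π(x)`.
The loop at `x` contributes nothing to `L`, so Cauchy–Schwarz costs only the loop-free degree, at
most `(1 - γ) π(x)`. -/
theorem lazy_mul_add_netAvg_sq_le [DecidableEq V] (hw : ∀ x y, 0 ≤ w x y) {γ : ℝ} {x : V} (hx : x ∈ W)
    (hd : 0 < netDeg W w x) (hγ : γ * netDeg W w x ≤ w x x) (f : V → ℝ) :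
    γ * ∑ y ∈ W, w x y * (f x - f y) ^ 2 + netDeg W w x * netAvg W w f x ^ 2 ≤
      ∑ y ∈ W, w x y * f y ^ 2 := by
  set Q := ∑ y ∈ W, w x y * (f x - f y) ^ 2 with hQ
  set L := ∑ y ∈ W, w x y * (f y - f x) with hL
  have hQ0 : 0 ≤ Q := Finset.sum_nonneg fun y _ => mul_nonneg (hw x y) (sq_nonneg _)
  have hQe : Q = ∑ y ∈ W.erase x, w x y * (f x - f y) ^ 2 := by
    rw [hQ, ← Finset.add_sum_erase _ _ hx]; simp
  have hLe : L = ∑ y ∈ W.erase x, w x y * (f y - f x) := by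
    rw [hL, ← Finset.add_sum_erase _ _ hx]; simp
  have hde : netDeg W w x - w x x = ∑ y ∈ W.erase x, w x y := by
    rw [netDeg, ← Finset.add_sum_erase _ _ hx]; ring
  have hCS : L ^ 2 ≤ (netDeg W w x - w x x) * Q := by
    rw [hLe, hde, hQe]
    refine Finset.sum_sq_le_sum_mul_sum_of_sq_le_mul _ (fun y _ => hw x y)
      (fun y _ => mul_nonneg (hw x y) (sq_nonneg _)) fun y _ => le_of_eq (by ring)
  have hsum : ∑ y ∈ W, w x y * f y = L + netDeg W w x * f x := by
    rw [hL, netDeg, Finset.sum_mul, ← Finset.sum_add_distrib]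
    exact Finset.sum_congr rfl fun y _ => by ring
  have hsq : ∑ y ∈ W, w x y * f y ^ 2 = Q + 2 * f x * L + netDeg W w x * f x ^ 2 := by
    rw [hL, hQ, netDeg, Finset.sum_mul, Finset.mul_sum, ← Finset.sum_add_distrib,
      ← Finset.sum_add_distrib]
    exact Finset.sum_congr rfl fun y _ => by ring
  rw [hsq, netAvg, hsum]
  set d := netDeg W w x
  have h1 : d * ((L + d * f x) / d) ^ 2 = L ^ 2 / d + 2 * f x * L + d * f x ^ 2 := by
    field_simp
    ring
  have h2 : L ^ 2 / d ≤ (1 - γ) * Q := by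
    rw [div_le_iff₀ hd]
    nlinarith [mul_le_mul_of_nonneg_right hγ hQ0]
  rw [h1]
  linarith

/-- One step of the walk contracts the variance. -/
theorem sum_netAvg_sq_le [DecidableEq V] (hw : ∀ x y, 0 ≤ w x y) (hsymm : ∀ x y, w x y = w y x)
    {κ γ : ℝ} (hκ0 : 0 ≤ κ) (hκ : HasConductance W w κ) (hγ0 : 0 ≤ γ)
    (hW : W.Nonempty) (hd : ∀ x ∈ W, 0 < netDeg W w x)
    (hγ : ∀ x ∈ W, γ * netDeg W w x ≤ w x x) (f : V → ℝ) :
    ∑ x ∈ W, netDeg W w x * netAvg W w f x ^ 2 ≤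
      Real.exp (-(γ * κ ^ 2)) * ∑ x ∈ W, netDeg W w x * f x ^ 2 +
      (1 - Real.exp (-(γ * κ ^ 2))) *
        ((∑ x ∈ W, netDeg W w x * f x) ^ 2 / ∑ x ∈ W, netDeg W w x) := by
  have hv : 0 < ∑ x ∈ W, netDeg W w x := Finset.sum_pos hd hW
  have h1 : γ * ∑ x ∈ W, ∑ y ∈ W, w x y * (f x - f y) ^ 2 +
      ∑ x ∈ W, netDeg W w x * netAvg W w f x ^ 2 ≤ ∑ x ∈ W, netDeg W w x * f x ^ 2 := by
    rw [← sum_netDeg_mul_right hsymm fun x => f x ^ 2, Finset.mul_sum, ← Finset.sum_add_distrib]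
    exact Finset.sum_le_sum fun x hx => lazy_mul_add_netAvg_sq_le hw hx (hd x hx) (hγ x hx) f
  have h2 := mul_le_mul_of_nonneg_left (poincare hw hsymm hκ0 hκ hv f) hγ0
  have hCS : (∑ x ∈ W, netDeg W w x * f x) ^ 2 ≤
      (∑ x ∈ W, netDeg W w x) * ∑ x ∈ W, netDeg W w x * f x ^ 2 :=
    Finset.sum_sq_le_sum_mul_sum_of_sq_le_mul _ (fun x hx => (hd x hx).le)
      (fun x hx => mul_nonneg (hd x hx).le (sq_nonneg _)) fun x _ => le_of_eq (by ring)
  have hvar : 0 ≤ ∑ x ∈ W, netDeg W w x * f x ^ 2 -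
      (∑ x ∈ W, netDeg W w x * f x) ^ 2 / ∑ x ∈ W, netDeg W w x := by
    rw [sub_nonneg, div_le_iff₀ hv]
    linarith
  have h3 := mul_le_mul_of_nonneg_right (Real.one_sub_le_exp_neg (γ * κ ^ 2)) hvar
  linarith

end FiniteNetwork

section GrowingNetwork

/-! ### Heat kernel bounds for lazy random walk on a growing finite network -/

variable {V : Type*} [DecidableEq V] {W : ℕ → Finset V} {w : ℕ → V → V → ℝ} {κ : ℕ → ℝ} {γ Δ : ℝ}

/-- A growing sequence of finite networks `w t` on `W t`, with conductances at least `κ t`,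
laziness `γ` and degrees at most `Δ`. -/
structure IsGrowingNetwork (W : ℕ → Finset V) (w : ℕ → V → V → ℝ) (κ : ℕ → ℝ) (γ Δ : ℝ) :
    Prop where
  nonneg : ∀ t x y, 0 ≤ w t x y
  symm : ∀ t x y, w t x y = w t y x
  subset_succ : ∀ t, W t ⊆ W (t + 1)
  closed : ∀ t, ∀ x ∈ W t, ∀ y ∉ W t, w t x y = 0
  deg_pos : ∀ t, ∀ x ∈ W t, 0 < netDeg (W t) (w t) x
  deg_le : ∀ t, ∀ x ∈ W t, netDeg (W t) (w t) x ≤ Δ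
  deg_le_succ : ∀ t, ∀ x ∈ W t, netDeg (W t) (w t) x ≤ netDeg (W (t + 1)) (w (t + 1)) x
  lazy_nonneg : 0 ≤ γ
  lazy : ∀ t, ∀ x ∈ W t, γ * netDeg (W t) (w t) x ≤ w t x x
  conductance_nonneg : ∀ t, 0 ≤ κ t
  conductance : ∀ t, HasConductance (W t) (w t) (κ t)

/-- The volume of the network at time `t`. -/
def netVol (W : ℕ → Finset V) (w : ℕ → V → V → ℝ) (t : ℕ) : ℝ :=
  ∑ x ∈ W t, netDeg (W t) (w t) x

/-- `q t` is the distribution at time `t` of a walk on the growing network. -/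
structure IsNetworkLaw (W : ℕ → Finset V) (w : ℕ → V → V → ℝ) (q : ℕ → V → ℝ) : Prop where
  sum_eq_one : ∀ t, ∑ x ∈ W t, q t x = 1
  eq_zero : ∀ t, ∀ x ∉ W t, q t x = 0
  succ : ∀ t y, q (t + 1) y = ∑ x ∈ W t, q t x * (w t x y / netDeg (W t) (w t) x)

/-- The `n`-step transition kernel from time `s`. -/
noncomputable def netKernel (W : ℕ → Finset V) (w : ℕ → V → V → ℝ) (y : V) : ℕ → ℕ → V → ℝ
  | 0, _, x => if x = y then 1 else 0
  | n + 1, s, x => netAvg (W s) (w s) (netKernel W w y n (s + 1)) x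

/-- The energy `∑ q² / π` of the law at time `t`. -/
noncomputable def energy (W : ℕ → Finset V) (w : ℕ → V → V → ℝ) (q : ℕ → V → ℝ) (t : ℕ) : ℝ :=
  ∑ x ∈ W t, q t x ^ 2 / netDeg (W t) (w t) x

namespace IsGrowingNetwork

variable (h : IsGrowingNetwork W w κ γ Δ)
include h

theorem netVol_mono : Monotone (netVol W w) :=
  monotone_nat_of_le_succ fun t =>
    (Finset.sum_le_sum fun x hx => h.deg_le_succ t x hx).trans
      (Finset.sum_le_sum_of_subset_of_nonneg (h.subset_succ t) fun x _ _ =>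
        netDeg_nonneg (h.nonneg _) x)

theorem netVol_pos {t : ℕ} (hW : (W t).Nonempty) : 0 < netVol W w t :=
  Finset.sum_pos (h.deg_pos t) hW

/-- By symmetry of the weights, the density `q / π` evolves under the averaging operator, so the
variance contraction applies, with `∑ π f = ∑ q = 1`. Passing to the larger degrees of time `t + 1`
only lowers the energy. -/
theorem energy_succ_le {q : ℕ → V → ℝ} (hq : IsNetworkLaw W w q) {t : ℕ} (hW : (W t).Nonempty) :
    energy W w q (t + 1) ≤ Real.exp (-(γ * κ t ^ 2)) * energy W w q t +
      (1 - Real.exp (-(γ * κ t ^ 2))) * (netVol W w t)⁻¹ := by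
  set f : V → ℝ := fun x => q t x / netDeg (W t) (w t) x with hf
  have hstep : ∀ y ∈ W t, q (t + 1) y = netDeg (W t) (w t) y * netAvg (W t) (w t) f y := by
    intro y hy
    rw [netAvg, mul_div_cancel₀ _ (h.deg_pos t y hy).ne', hq.succ]
    refine Finset.sum_congr rfl fun x _ => ?_
    rw [h.symm t x y]
    ring
  -- The step from `t` to `t + 1` uses edges of time `t`, so vertices added at time `t + 1` carry no
  -- mass yet.
  have hzero : ∀ y ∈ W (t + 1), y ∉ W t →
      q (t + 1) y ^ 2 / netDeg (W (t + 1)) (w (t + 1)) y = 0 := by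
    intro y _ hy
    have : q (t + 1) y = 0 := by
      rw [hq.succ]
      exact Finset.sum_eq_zero fun x hx => by rw [h.closed t x hx y hy]; simp
    rw [this]
    simp
  have hmain := sum_netAvg_sq_le (h.nonneg t) (h.symm t) (h.conductance_nonneg t)
    (h.conductance t) h.lazy_nonneg hW (h.deg_pos t) (h.lazy t) f
  have h1 : ∑ x ∈ W t, netDeg (W t) (w t) x * f x = 1 := by
    rw [← hq.sum_eq_one t]
    exact Finset.sum_congr rfl fun x hx => mul_div_cancel₀ _ (h.deg_pos t x hx).ne'
  have h2 : ∑ x ∈ W t, netDeg (W t) (w t) x * f x ^ 2 = energy W w q t := by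
    refine Finset.sum_congr rfl fun x hx => ?_
    have := (h.deg_pos t x hx).ne'
    simp only [hf]
    field_simp
  rw [h1, h2, one_pow, one_div] at hmain
  refine le_trans ?_ hmain
  rw [energy, ← Finset.sum_subset (h.subset_succ t) hzero]
  refine Finset.sum_le_sum fun x hx => ?_
  have hpos := h.deg_pos t x hx
  calc q (t + 1) x ^ 2 / netDeg (W (t + 1)) (w (t + 1)) x
      ≤ q (t + 1) x ^ 2 / netDeg (W t) (w t) x :=
        div_le_div_of_nonneg_left (sq_nonneg _) hpos (h.deg_le_succ t x hx)
    _ = _ := by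
        rw [hstep x hx]
        field_simp

theorem nonempty_of_le {r s : ℕ} (hrs : r ≤ s) (hW : (W r).Nonempty) : (W s).Nonempty :=
  hW.mono (monotone_nat_of_le_succ h.subset_succ hrs)

theorem exp_conductance_le_one (t : ℕ) : Real.exp (-(γ * κ t ^ 2)) ≤ 1 :=
  Real.exp_le_one_iff.2 (neg_nonpos.2 (mul_nonneg h.lazy_nonneg (sq_nonneg _)))

theorem energy_le {q : ℕ → V → ℝ} (hq : IsNetworkLaw W w q) {r s : ℕ} (hrs : r ≤ s)
    (hW : (W r).Nonempty) :
    energy W w q s ≤ (netVol W w r)⁻¹ +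
      Real.exp (-(γ * ∑ u ∈ Finset.Ico r s, κ u ^ 2)) * energy W w q r := by
  have hv := h.netVol_pos hW
  induction s, hrs using Nat.le_induction with
  | base => simp [hv.le]
  | succ s hrs ih =>
    have h1 := h.energy_succ_le hq (h.nonempty_of_le hrs hW)
    have h2 : (netVol W w s)⁻¹ ≤ (netVol W w r)⁻¹ := inv_anti₀ hv (h.netVol_mono hrs)
    rw [Finset.sum_Ico_succ_top hrs, mul_add, neg_add, Real.exp_add]
    have h3 := mul_le_mul_of_nonneg_left ih (Real.exp_pos (-(γ * κ s ^ 2))).le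
    have h4 := mul_le_mul_of_nonneg_left h2 (sub_nonneg.2 (h.exp_conductance_le_one s))
    linarith

theorem netKernel_nonneg (y : V) (n s : ℕ) (x : V) : 0 ≤ netKernel W w y n s x := by
  induction n generalizing s x with
  | zero => unfold netKernel; split_ifs <;> norm_num
  | succ n ih =>
    exact div_nonneg (Finset.sum_nonneg fun z _ => mul_nonneg (h.nonneg _ _ _) (ih _ _))
      (netDeg_nonneg (h.nonneg _) _)

theorem law_add {q : ℕ → V → ℝ} (hq : IsNetworkLaw W w q) (n s : ℕ) {y : V} (hy : y ∈ W s) :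
    q (s + n) y = ∑ x ∈ W s, q s x * netKernel W w y n s x := by
  induction n generalizing s with
  | zero => simp [netKernel, hy]
  | succ n ih =>
    rw [← add_assoc, add_right_comm, ih (s + 1) (h.subset_succ s hy),
      ← Finset.sum_subset (h.subset_succ s)]
    · simp only [netKernel, netAvg, hq.succ, Finset.sum_mul, Finset.mul_sum, Finset.sum_div]
      rw [Finset.sum_comm]
      exact Finset.sum_congr rfl fun x _ => Finset.sum_congr rfl fun z _ => by ring
    · intro x _ hx
      rw [hq.succ, Finset.sum_eq_zero, zero_mul]
      intro z hz
      rw [h.closed s z hz x hx]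
      simp

theorem sum_deg_mul_le_succ {f : V → ℝ} (hf : ∀ x, 0 ≤ f x) (s : ℕ) :
    ∑ x ∈ W s, netDeg (W s) (w s) x * f x ≤
      ∑ x ∈ W (s + 1), netDeg (W (s + 1)) (w (s + 1)) x * f x :=
  (Finset.sum_le_sum fun x hx => mul_le_mul_of_nonneg_right (h.deg_le_succ s x hx) (hf x)).trans
    (Finset.sum_le_sum_of_subset_of_nonneg (h.subset_succ s) fun x _ _ =>
      mul_nonneg (netDeg_nonneg (h.nonneg _) x) (hf x))

/-- Averaging preserves the `π_s`-integral, and replacing `π_s` by `π_{s+1}` only increases it. At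
the terminal time it equals the degree of `y`. -/
theorem sum_deg_mul_netKernel_le (n s : ℕ) {y : V} (hy : y ∈ W s) :
    ∑ x ∈ W s, netDeg (W s) (w s) x * netKernel W w y n s x ≤ Δ := by
  induction n generalizing s with
  | zero => simpa [netKernel, hy] using h.deg_le s y hy
  | succ n ih =>
    refine le_trans ?_ (ih (s + 1) (h.subset_succ s hy))
    refine le_trans (le_of_eq ?_) (h.sum_deg_mul_le_succ (h.netKernel_nonneg y n (s + 1)) s)
    rw [← sum_netDeg_mul_right (h.symm s) (netKernel W w y n (s + 1))]
    refine Finset.sum_congr rfl fun x hx => ?_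
    exact mul_div_cancel₀ _ (h.deg_pos s x hx).ne'

/-- The backward counterpart of `energy_le`. The time `r` is fixed while `s` varies in the
induction, so every volume met is bounded below by the one at `r`. -/
theorem sum_deg_mul_netKernel_sq_le (n : ℕ) {r s : ℕ} (hrs : r ≤ s) {y : V} (hy : y ∈ W r) :
    ∑ x ∈ W s, netDeg (W s) (w s) x * netKernel W w y n s x ^ 2 ≤ Δ ^ 2 * (netVol W w r)⁻¹ +
      Real.exp (-(γ * ∑ u ∈ Finset.Ico s (s + n), κ u ^ 2)) * Δ := by
  have hv := h.netVol_pos ⟨y, hy⟩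
  induction n generalizing s with
  | zero =>
    have hys := monotone_nat_of_le_succ h.subset_succ hrs hy
    have : 0 ≤ Δ ^ 2 * (netVol W w r)⁻¹ := mul_nonneg (sq_nonneg _) (inv_nonneg.2 hv.le)
    simp only [netKernel, ite_pow, mul_ite]
    simpa [hys] using (h.deg_le s y hys).trans (le_add_of_nonneg_left this)
  | succ n ih =>
    have hys := monotone_nat_of_le_succ h.subset_succ hrs hy
    have hK := h.netKernel_nonneg y n (s + 1)
    have h1 := sum_netAvg_sq_le (h.nonneg s) (h.symm s) (h.conductance_nonneg s)
      (h.conductance s) h.lazy_nonneg ⟨y, hys⟩ (h.deg_pos s) (h.lazy s)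
      (netKernel W w y n (s + 1))
    have h2 := (h.sum_deg_mul_le_succ (fun x => sq_nonneg (netKernel W w y n (s + 1) x)) s).trans
      (ih (hrs.trans s.le_succ))
    have h3 : (∑ x ∈ W s, netDeg (W s) (w s) x * netKernel W w y n (s + 1) x) ^ 2 /
        ∑ x ∈ W s, netDeg (W s) (w s) x ≤ Δ ^ 2 * (netVol W w r)⁻¹ := by
      rw [div_eq_mul_inv]
      refine mul_le_mul (pow_le_pow_left₀ (Finset.sum_nonneg fun x _ =>
        mul_nonneg (netDeg_nonneg (h.nonneg _) x) (hK x)) ?_ 2)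
        (inv_anti₀ hv (h.netVol_mono hrs)) (inv_nonneg.2 (h.netVol_pos ⟨y, hys⟩).le)
        (sq_nonneg _)
      exact (h.sum_deg_mul_le_succ hK s).trans
        (h.sum_deg_mul_netKernel_le n (s + 1) (h.subset_succ s hys))
    have h4 := mul_le_mul_of_nonneg_left h2 (Real.exp_pos (-(γ * κ s ^ 2))).le
    have h5 := mul_le_mul_of_nonneg_left h3 (sub_nonneg.2 (h.exp_conductance_le_one s))
    rw [Finset.sum_eq_sum_Ico_succ_bot (by omega : s < s + (n + 1)), mul_add, neg_add,
      Real.exp_add, show s + (n + 1) = s + 1 + n by omega]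
    simp only [netKernel]
    linarith

/-- The heat kernel bound. -/
theorem law_le {q : ℕ → V → ℝ} (hq : IsNetworkLaw W w q) {r s t : ℕ} (hrs : r ≤ s) (hst : s ≤ t)
    {y : V} (hy : y ∈ W 0) :
    q t y ≤ (1 + Δ ^ 2) * (netVol W w r)⁻¹ +
      ((netVol W w 0)⁻¹ + energy W w q 0) *
        Real.exp (-(γ * ∑ u ∈ Finset.Ico r s, κ u ^ 2)) +
      Δ * Real.exp (-(γ * ∑ u ∈ Finset.Ico s t, κ u ^ 2)) := by
  obtain ⟨n, rfl⟩ := Nat.exists_eq_add_of_le hst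
  have hmono := monotone_nat_of_le_succ h.subset_succ
  have hyr := hmono r.zero_le hy
  have hys := hmono s.zero_le hy
  have h0 : 0 ≤ energy W w q 0 := Finset.sum_nonneg fun x _ =>
    div_nonneg (sq_nonneg _) (netDeg_nonneg (h.nonneg _) x)
  -- The prefactor of the first exponential must not depend on `r`.
  have hr : energy W w q r ≤ (netVol W w 0)⁻¹ + energy W w q 0 := by
    refine (h.energy_le hq r.zero_le ⟨y, hy⟩).trans (add_le_add_right
      (mul_le_of_le_one_left h0 (Real.exp_le_one_iff.2 (neg_nonpos.2
        (mul_nonneg h.lazy_nonneg (Finset.sum_nonneg fun u _ => sq_nonneg _))))) _)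
  have h1 := h.energy_le hq hrs ⟨y, hyr⟩
  have h2 := h.sum_deg_mul_netKernel_sq_le n hrs hyr
  have h3 : q (s + n) y ≤ energy W w q s +
      ∑ x ∈ W s, netDeg (W s) (w s) x * netKernel W w y n s x ^ 2 := by
    rw [h.law_add hq n s hys, energy, ← Finset.sum_add_distrib]
    refine Finset.sum_le_sum fun x hx => ?_
    have hd := h.deg_pos s x hx
    set K := netKernel W w y n s x
    set d := netDeg (W s) (w s) x
    have h4 : q s x ^ 2 / d + d * K ^ 2 - q s x * K =
        ((q s x - d * K) ^ 2 + q s x ^ 2 + (d * K) ^ 2) / (2 * d) := by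
      field_simp
      ring
    have h5 : 0 ≤ ((q s x - d * K) ^ 2 + q s x ^ 2 + (d * K) ^ 2) / (2 * d) := by positivity
    linarith
  have h4 := mul_le_mul_of_nonneg_left hr
    (Real.exp_pos (-(γ * ∑ u ∈ Finset.Ico r s, κ u ^ 2))).le
  linarith

end IsGrowingNetwork

end GrowingNetwork

section Summability

/-! ### Summation over dyadic scales -/

/-- Each value of `t / N` is taken exactly `N` times. -/
theorem summable_comp_div {u : ℕ → ℝ} (h0 : ∀ t, 0 ≤ u t) (hu : Summable u) {N : ℕ}
    (hN : N ≠ 0) : Summable fun t => u (t / N) := by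
  have : NeZero N := ⟨hN⟩
  rw [← (Nat.divModEquiv N).symm.summable_iff]
  have h : ((fun t => u (t / N)) ∘ (Nat.divModEquiv N).symm) =
      fun p : ℕ × Fin N => u p.1 * 1 := by
    funext p
    simp only [Function.comp_apply, Nat.divModEquiv_symm_apply, mul_one]
    rw [mul_comm, add_comm, Nat.add_mul_div_left _ _ (Nat.pos_of_ne_zero hN),
      Nat.div_eq_of_lt p.2.2, zero_add]
  rw [h]
  exact hu.mul_of_nonneg (g := fun _ : Fin N => (1 : ℝ)) Summable.of_finite h0
    fun _ => zero_le_one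

theorem sum_Ico_div_two_pow (f : ℕ → ℝ) (t M : ℕ) :
    ∑ u ∈ Finset.Ico (t / 2 ^ M) t, f u =
      ∑ k ∈ Finset.range M, ∑ u ∈ Finset.Ico (t / 2 ^ k / 2) (t / 2 ^ k), f u := by
  induction M with
  | zero => simp
  | succ M ih =>
    rw [Finset.sum_range_succ, ← ih, pow_succ, ← Nat.div_div_eq_div_mul, add_comm]
    exact (Finset.sum_Ico_consecutive f (Nat.div_le_self _ _) (Nat.div_le_self _ _)).symm

/-- Summability of `exp (-S t)` over the last dyadic scale upgrades to summability with any
positive factor in the exponent, at the expense of using more scales. -/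
theorem summable_exp_neg_mul_sum {f : ℕ → ℝ} (hf : ∀ t, 0 ≤ f t)
    (hs : Summable fun t : ℕ => Real.exp (-∑ u ∈ Finset.Ico (t / 2) t, f u))
    {γ : ℝ} {M : ℕ} (hM : 1 ≤ γ * M) :
    Summable fun t : ℕ => Real.exp (-(γ * ∑ u ∈ Finset.Ico (t / 2 ^ M) t, f u)) := by
  have hM0 : (M : ℝ) ≠ 0 := fun h => by rw [h, mul_zero] at hM; linarith
  have hMpos : (0 : ℝ) < M := lt_of_le_of_ne M.cast_nonneg hM0.symm
  have hk : ∀ k, Summable fun t : ℕ =>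
      Real.exp (-∑ u ∈ Finset.Ico (t / 2 ^ k / 2) (t / 2 ^ k), f u) := fun k =>
    summable_comp_div (fun t => (Real.exp_pos _).le) hs (pow_ne_zero k two_ne_zero)
  refine Summable.of_nonneg_of_le (fun t => (Real.exp_pos _).le) (fun t => ?_)
    (summable_sum fun k (_ : k ∈ Finset.range M) => (hk k).mul_left (M : ℝ)⁻¹)
  -- Jensen with weights `1 / M`: an average of the exponents over `M` dyadic scales is bounded by
  -- the average of `M` summable exponentials. The condition `1 / M ≤ γ` lets that average replace
  -- `γ` times the sum.
  have hJ := convexOn_exp.map_sum_le (t := Finset.range M) (w := fun _ => (M : ℝ)⁻¹)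
    (p := fun k => -∑ u ∈ Finset.Ico (t / 2 ^ k / 2) (t / 2 ^ k), f u)
    (fun _ _ => (inv_pos.2 hMpos).le) (by simp [hM0]) (fun _ _ => Set.mem_univ _)
  simp only [smul_eq_mul] at hJ
  refine le_trans (Real.exp_le_exp.2 ?_) hJ
  rw [← Finset.mul_sum, Finset.sum_neg_distrib, ← sum_Ico_div_two_pow, mul_neg, neg_le_neg_iff]
  refine mul_le_mul_of_nonneg_right ?_ (Finset.sum_nonneg fun u _ => hf u)
  rw [inv_le_iff_one_le_mul₀ hMpos]
  exact hM

variable {V : Type*} [DecidableEq V] {W : ℕ → Finset V} {w : ℕ → V → V → ℝ} {κ : ℕ → ℝ} {γ Δ : ℝ}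

theorem IsGrowingNetwork.summable_law (h : IsGrowingNetwork W w κ γ Δ) (hγ : 0 < γ)
    {q : ℕ → V → ℝ} (hq0 : ∀ t x, 0 ≤ q t x) (hq : IsNetworkLaw W w q) {y : V} (hy : y ∈ W 0)
    (hvol : Summable fun t => (netVol W w t)⁻¹)
    (hmix : Summable fun t : ℕ => Real.exp (-∑ u ∈ Finset.Ico (t / 2) t, κ u ^ 2)) :
    Summable fun t => q t y := by
  obtain ⟨M, hM⟩ := exists_nat_ge γ⁻¹
  have hM1 : 1 ≤ γ * M := by rwa [inv_le_iff_one_le_mul₀' hγ] at hM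
  have hs := summable_exp_neg_mul_sum (fun t => sq_nonneg (κ t)) hmix hM1
  have h2 : (2 ^ M : ℕ) ≠ 0 := pow_ne_zero M two_ne_zero
  have hs' := summable_comp_div (fun t => (Real.exp_pos _).le) hs h2
  have hv := summable_comp_div (fun t => inv_nonneg.2 (h.netVol_pos
    ⟨y, monotone_nat_of_le_succ h.subset_succ t.zero_le hy⟩).le) hvol (mul_ne_zero h2 h2)
  refine Summable.of_nonneg_of_le (fun t => hq0 t y) (fun t => ?_)
    (((hv.mul_left (1 + Δ ^ 2)).add (hs'.mul_left ((netVol W w 0)⁻¹ + energy W w q 0))).add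
      (hs.mul_left Δ))
  -- Take `s = t / 2 ^ M` and `r = s / 2 ^ M`, so that `[r, s)` and `[s, t)` each cover `M`
  -- halvings.
  rw [← Nat.div_div_eq_div_mul]
  exact h.law_le hq (Nat.div_le_self _ _) (Nat.div_le_self _ _) hy

end Summability

section GraphNetwork

/-! ### The networks attached to a growing sequence of graphs -/

variable {V E : Type*} {Ginf : Graph V E} {G : ℕ → Graph V E}

theorem edgeCount_nonneg (H : Graph V E) (x y : V) : 0 ≤ edgeCount H x y := Nat.cast_nonneg _

theorem edgeCount_comm (H : Graph V E) (x y : V) : edgeCount H x y = edgeCount H y x := by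
  simp only [edgeCount, H.isLink_comm (x := x) (y := y)]

theorem edgeCount_eq_zero {H : Graph V E} {x y : V} (hx : x ∈ nonIsolated H)
    (hy : y ∉ nonIsolated H) : edgeCount H x y = 0 := by
  have : {e : E | H.IsLink e x y} = ∅ := by
    refine Set.eq_empty_iff_forall_notMem.2 fun e he => hy ⟨x, ?_, e, he.symm⟩
    rintro rfl
    exact hy hx
  simp [edgeCount, this]

namespace IsGrowing

variable (hG : IsGrowing Ginf G)
include hG

/-- Since `ncard` is zero on infinite sets, this finiteness is what makes edge counts monotone in
time and degrees positive. -/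
theorem finite_isLink (t : ℕ) (x y : V) : {e : E | (G t).IsLink e x y}.Finite := by
  by_cases hx : x ∈ Ginf.vertexSet
  · exact (hG.locallyFinite x hx).subset fun e he => ⟨y, (hG.spanning t).isLink_mono he⟩
  · refine Set.finite_empty.subset fun e he => hx ?_
    exact ((hG.spanning t).isLink_mono he).left_mem

theorem edgeCount_le_succ (t : ℕ) (x y : V) : edgeCount (G t) x y ≤ edgeCount (G (t + 1)) x y :=
  Nat.cast_le.2 (Set.ncard_le_ncard (fun _ he => (hG.mono t).isLink_mono he)
    (hG.finite_isLink (t + 1) x y))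

/-- The non-isolated vertices at time `t`, as a finite set. -/
noncomputable def verts (t : ℕ) : Finset V := (hG.finite_nonIsolated t).toFinset

theorem mem_verts {t : ℕ} {x : V} : x ∈ hG.verts t ↔ x ∈ nonIsolated (G t) :=
  Set.Finite.mem_toFinset _

theorem coe_verts (t : ℕ) : (hG.verts t : Set V) = nonIsolated (G t) :=
  Set.Finite.coe_toFinset _

theorem degree_eq (t : ℕ) (x : V) : degree (G t) x = netDeg (hG.verts t) (edgeCount (G t)) x := by
  rw [degree, netDeg, ← hG.coe_verts t, finsum_mem_coe_finset]

theorem degreeSum_eq (t : ℕ) (A : Finset V) :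
    degreeSum (G t) A = ∑ x ∈ A, netDeg (hG.verts t) (edgeCount (G t)) x := by
  rw [degreeSum, finsum_mem_coe_finset]
  simp only [hG.degree_eq]

theorem vol_eq (t : ℕ) : vol (G t) = netVol hG.verts (fun t => edgeCount (G t)) t := by
  rw [vol, ← hG.coe_verts t, hG.degreeSum_eq, netVol]

theorem verts_subset_succ (t : ℕ) : hG.verts t ⊆ hG.verts (t + 1) := by
  intro x hx
  obtain ⟨y, hyx, e, he⟩ := hG.mem_verts.1 hx
  exact hG.mem_verts.2 ⟨y, hyx, e, (hG.mono t).isLink_mono he⟩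

theorem netDeg_pos {t : ℕ} {x : V} (hx : x ∈ hG.verts t) :
    0 < netDeg (hG.verts t) (edgeCount (G t)) x := by
  obtain ⟨y, hyx, e, he⟩ := hG.mem_verts.1 hx
  have hy : y ∈ hG.verts t := hG.mem_verts.2 ⟨x, hyx.symm, e, he.symm⟩
  refine Finset.sum_pos' (fun z _ => edgeCount_nonneg _ x z) ⟨y, hy, ?_⟩
  exact Nat.cast_pos.2 ((Set.ncard_pos (hG.finite_isLink t x y)).2 ⟨e, he⟩)

variable [DecidableEq V]

theorem flow_eq (t : ℕ) (A : Finset V) :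
    flow (G t) A (nonIsolated (G t) \ A) =
      ∑ x ∈ A, ∑ y ∈ hG.verts t \ A, edgeCount (G t) x y := by
  rw [flow, ← hG.coe_verts t, ← Finset.coe_sdiff, finsum_mem_coe_finset]
  simp only [finsum_mem_coe_finset]

theorem hasConductance_cheeger (t : ℕ) :
    HasConductance (hG.verts t) (edgeCount (G t)) (cheeger (G t)) := by
  intro A hA hne hle
  have hpos : 0 < ∑ x ∈ A, netDeg (hG.verts t) (edgeCount (G t)) x :=
    Finset.sum_pos (fun x hx => hG.netDeg_pos (hA hx)) hne
  rw [← le_div_iff₀ hpos]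
  have hadm : (A : Set V) ⊆ nonIsolated (G t) ∧ (A : Set V).Nonempty ∧
      degreeSum (G t) A ≤ min (vol (G t) / 2) (vol (G t) / 2) := by
    refine ⟨fun x hx => hG.mem_verts.1 (hA hx), hne, ?_⟩
    rw [min_self, hG.degreeSum_eq, hG.vol_eq]
    exact hle
  have hinf : isoperimetric (G t) (vol (G t) / 2) ≤
      ENNReal.ofReal (flow (G t) A (nonIsolated (G t) \ A) / degreeSum (G t) A) :=
    iInf₂_le (A : Set V) hadm
  rw [hG.flow_eq, hG.degreeSum_eq] at hinf
  refine ENNReal.toReal_le_of_le_ofReal (div_nonneg (Finset.sum_nonneg fun x _ =>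
    Finset.sum_nonneg fun y _ => edgeCount_nonneg _ x y) hpos.le) hinf

theorem isGrowingNetwork {γ Δ : ℝ} (hγ : 0 ≤ γ)
    (hlazy : ∀ t, ∀ x ∈ nonIsolated (G t), γ ≤ stepProb (G t) x x)
    (hdeg : ∀ t, ∀ x ∈ nonIsolated (G t), degree (G t) x ≤ Δ) :
    IsGrowingNetwork hG.verts (fun t => edgeCount (G t)) (fun t => cheeger (G t)) γ Δ where
  nonneg t := edgeCount_nonneg (G t)
  symm t := edgeCount_comm (G t)
  subset_succ := hG.verts_subset_succ
  closed t x hx y hy := edgeCount_eq_zero (hG.mem_verts.1 hx) (mt hG.mem_verts.2 hy)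
  deg_pos t x hx := hG.netDeg_pos hx
  deg_le t x hx := by
    rw [← hG.degree_eq]
    exact hdeg t x (hG.mem_verts.1 hx)
  deg_le_succ t x _ :=
    (Finset.sum_le_sum fun y _ => hG.edgeCount_le_succ t x y).trans
      (Finset.sum_le_sum_of_subset_of_nonneg (hG.verts_subset_succ t) fun y _ _ =>
        edgeCount_nonneg _ x y)
  lazy_nonneg := hγ
  lazy t x hx := by
    have := hlazy t x (hG.mem_verts.1 hx)
    rwa [stepProb, hG.degree_eq, le_div_iff₀ (hG.netDeg_pos hx)] at this
  conductance_nonneg t := ENNReal.toReal_nonneg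
  conductance := hG.hasConductance_cheeger

omit [DecidableEq V] in
theorem sum_stepProb {t : ℕ} {x : V} (hx : x ∈ hG.verts t) :
    ∑ y ∈ hG.verts t, stepProb (G t) x y = 1 := by
  simp only [stepProb, ← Finset.sum_div]
  rw [hG.degree_eq]
  exact div_self (hG.netDeg_pos hx).ne'

end IsGrowing

end GraphNetwork

section WalkLaw

/-! ### The law of the walk -/

variable {V E Ω : Type*}

/-- The trajectory `X` up to time `t`, continued by the constant `x₀`. -/
noncomputable def stoppedPath (X : ℕ → Ω → V) (x₀ : V) (t : ℕ) (ω : Ω) (i : ℕ) : V :=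
  if i ≤ t then X i ω else x₀

theorem stoppedPath_eq_iff {X : ℕ → Ω → V} {x₀ : V} {t : ℕ} {p : ℕ → V}
    (hp : ∀ i, t < i → p i = x₀) (ω : Ω) :
    stoppedPath X x₀ t ω = p ↔ ∀ i ≤ t, X i ω = p i := by
  constructor
  · rintro rfl i hi
    simp [stoppedPath, hi]
  · intro h
    funext i
    by_cases hi : i ≤ t
    · simp [stoppedPath, hi, h i hi]
    · simp [stoppedPath, hi, hp i (not_le.1 hi)]

variable [MeasurableSpace V] [DiscreteMeasurableSpace V] [MeasurableSpace Ω]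
  {μ : Measure Ω} {Ginf : Graph V E} {G : ℕ → Graph V E} {x₀ : V} {X : ℕ → Ω → V}

/-- `S` is a finite set of paths up to time `t` that almost surely contains the trajectory. -/
structure IsPathSupport (μ : Measure Ω) (X : ℕ → Ω → V) (x₀ : V) (Wt : Finset V) (t : ℕ)
    (S : Finset (ℕ → V)) : Prop where
  eq_start : ∀ p ∈ S, ∀ i, t < i → p i = x₀
  mem : ∀ p ∈ S, p t ∈ Wt
  ae_mem : ∀ᵐ ω ∂μ, stoppedPath X x₀ t ω ∈ S

namespace IsSimpleRandomWalk

variable (hX : IsSimpleRandomWalk G x₀ μ X)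
include hX

theorem measurableSet_stoppedPath_eq {t : ℕ} {p : ℕ → V} (hp : ∀ i, t < i → p i = x₀) :
    MeasurableSet {ω | stoppedPath X x₀ t ω = p} := by
  simp only [stoppedPath_eq_iff hp, Set.ofPred_forall]
  exact MeasurableSet.iInter fun i => MeasurableSet.iInter fun _ =>
    hX.measurable i (MeasurableSet.singleton (p i))

/-- `V` is not assumed countable, so events are decomposed over a finite set of paths carrying
almost all trajectories. -/
theorem measure_eq_sum {Wt : Finset V} {t : ℕ} {S : Finset (ℕ → V)}
    (hS : IsPathSupport μ X x₀ Wt t S) {B : Set Ω} (hB : MeasurableSet B) :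
    μ B = ∑ p ∈ S, μ ({ω | stoppedPath X x₀ t ω = p} ∩ B) := by
  rw [← measure_biUnion_finset]
  · refine measure_congr ?_
    filter_upwards [hS.ae_mem] with ω hω
    refine propext ⟨fun h => Set.mem_biUnion hω ⟨rfl, h⟩, fun h => ?_⟩
    obtain ⟨p, _, hp⟩ := Set.mem_iUnion₂.1 h
    exact hp.2
  · intro p _ p' _ hne
    refine Set.disjoint_left.2 fun ω h h' => hne ?_
    exact h.1.symm.trans h'.1
  · exact fun p hp => (hX.measurableSet_stoppedPath_eq (hS.eq_start p hp)).inter hB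

omit [DiscreteMeasurableSpace V] in
theorem measure_stoppedPath_inter {t : ℕ} {p : ℕ → V} (hp : ∀ i, t < i → p i = x₀) (y : V) :
    μ ({ω | stoppedPath X x₀ t ω = p} ∩ {ω | X (t + 1) ω = y}) =
      μ {ω | stoppedPath X x₀ t ω = p} * ENNReal.ofReal (stepProb (G t) (p t) y) := by
  -- The step axiom speaks of full paths: extend `p` by the value `y` at time `t + 1`.
  have h := hX.step t (Function.update p (t + 1) y)
  have hne : ∀ i ≤ t, i ≠ t + 1 := fun i hi => by omega
  have h1 : {ω | ∀ i ≤ t, X i ω = Function.update p (t + 1) y i} =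
      {ω | stoppedPath X x₀ t ω = p} := by
    ext ω
    simp only [Set.mem_ofPred_eq, stoppedPath_eq_iff hp]
    exact forall₂_congr fun i hi => by rw [Function.update_of_ne (hne i hi)]
  have h2 : {ω | ∀ i ≤ t + 1, X i ω = Function.update p (t + 1) y i} =
      {ω | stoppedPath X x₀ t ω = p} ∩ {ω | X (t + 1) ω = y} := by
    rw [← h1]
    ext ω
    constructor
    · intro hω
      refine ⟨fun i hi => hω i (by omega), ?_⟩
      simpa using hω (t + 1) le_rfl
    · rintro ⟨hω, hω'⟩ i hi
      rcases Nat.le_succ_iff.1 hi with hi | rfl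
      · exact hω i hi
      · simpa using hω'
  rwa [h1, h2, Function.update_self, Function.update_of_ne (hne t le_rfl)] at h

/-- The transition probabilities out of the endpoint of each supporting path sum to one over the
current vertices, so no mass escapes. -/
theorem ae_mem_succ [IsProbabilityMeasure μ] (hG : IsGrowing Ginf G) {t : ℕ}
    {S : Finset (ℕ → V)} (hS : IsPathSupport μ X x₀ (hG.verts t) t S) :
    ∀ᵐ ω ∂μ, X (t + 1) ω ∈ hG.verts t := by
  have hm : ∀ B : Set V, MeasurableSet {ω | X (t + 1) ω ∈ B} := fun B =>
    hX.measurable (t + 1) (MeasurableSet.of_discrete (s := B))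
  have hstep : ∀ p ∈ S, μ ({ω | stoppedPath X x₀ t ω = p} ∩ {ω | X (t + 1) ω ∈ hG.verts t}) =
      μ ({ω | stoppedPath X x₀ t ω = p} ∩ Set.univ) := by
    intro p hp
    have hU : {ω | stoppedPath X x₀ t ω = p} ∩ {ω | X (t + 1) ω ∈ hG.verts t} =
        ⋃ y ∈ hG.verts t, {ω | stoppedPath X x₀ t ω = p} ∩ {ω | X (t + 1) ω = y} := by
      ext ω
      simp
    rw [hU, measure_biUnion_finset]
    · simp only [hX.measure_stoppedPath_inter (hS.eq_start p hp)]
      rw [← Finset.mul_sum, ← ENNReal.ofReal_sum_of_nonneg, hG.sum_stepProb (hS.mem p hp),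
        ENNReal.ofReal_one, mul_one, Set.inter_univ]
      intro y _
      refine div_nonneg (edgeCount_nonneg _ _ _) ?_
      rw [hG.degree_eq]
      exact netDeg_nonneg (edgeCount_nonneg _) _
    · intro y _ y' _ hne
      exact Set.disjoint_left.2 fun ω h h' => hne (h.2.symm.trans h'.2)
    · exact fun y _ => (hX.measurableSet_stoppedPath_eq (hS.eq_start p hp)).inter (hm {y})
  have hmW : MeasurableSet {ω | X (t + 1) ω ∈ hG.verts t} := hm (hG.verts t)
  have h1 : μ {ω | X (t + 1) ω ∈ hG.verts t} = 1 := by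
    rw [hX.measure_eq_sum hS hmW, Finset.sum_congr rfl hstep,
      ← hX.measure_eq_sum hS MeasurableSet.univ, measure_univ]
  exact (prob_compl_eq_zero_iff hmW).2 h1

theorem exists_isPathSupport [IsProbabilityMeasure μ] (hG : IsGrowing Ginf G)
    (hx₀ : x₀ ∈ nonIsolated (G 0)) (t : ℕ) :
    ∃ S, IsPathSupport μ X x₀ (hG.verts t) t S := by
  classical
  induction t with
  | zero =>
    refine ⟨{fun _ => x₀}, by simp, by simpa using hG.mem_verts.2 hx₀, ?_⟩
    filter_upwards [hX.start] with ω hω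
    rw [Finset.mem_singleton, stoppedPath_eq_iff fun _ _ => rfl]
    intro i hi
    rwa [Nat.le_zero.1 hi]
  | succ t ih =>
    obtain ⟨S, hS⟩ := ih
    refine ⟨(S ×ˢ hG.verts t).image fun a => Function.update a.1 (t + 1) a.2, ?_, ?_, ?_⟩
    · intro p hp i hi
      obtain ⟨⟨p', y⟩, ha, rfl⟩ := Finset.mem_image.1 hp
      rw [Function.update_of_ne (by omega)]
      exact hS.eq_start p' (Finset.mem_product.1 ha).1 i (by omega)
    · intro p hp
      obtain ⟨⟨p', y⟩, ha, rfl⟩ := Finset.mem_image.1 hp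
      rw [Function.update_self]
      exact hG.verts_subset_succ t (Finset.mem_product.1 ha).2
    · filter_upwards [hS.ae_mem, hX.ae_mem_succ hG hS] with ω h1 h2
      refine Finset.mem_image.2 ⟨(stoppedPath X x₀ t ω, X (t + 1) ω),
        Finset.mem_product.2 ⟨h1, h2⟩, ?_⟩
      funext i
      rcases lt_trichotomy i (t + 1) with hi | rfl | hi
      · simp [stoppedPath, hi.ne, Nat.lt_succ_iff.1 hi, hi.le]
      · simp [stoppedPath]
      · simp [stoppedPath, hi.ne', not_le.2 hi, not_le.2 (Nat.lt_of_succ_lt hi)]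

theorem ae_mem_verts [IsProbabilityMeasure μ] (hG : IsGrowing Ginf G)
    (hx₀ : x₀ ∈ nonIsolated (G 0)) (t : ℕ) : ∀ᵐ ω ∂μ, X t ω ∈ hG.verts t := by
  obtain ⟨S, hS⟩ := hX.exists_isPathSupport hG hx₀ t
  filter_upwards [hS.ae_mem] with ω hω
  simpa [stoppedPath] using hS.mem _ hω

/-- The Chapman–Kolmogorov equation. -/
theorem measure_succ [IsProbabilityMeasure μ] (hG : IsGrowing Ginf G)
    (hx₀ : x₀ ∈ nonIsolated (G 0)) (t : ℕ) (y : V) :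
    μ {ω | X (t + 1) ω = y} =
      ∑ x ∈ hG.verts t, μ {ω | X t ω = x} * ENNReal.ofReal (stepProb (G t) x y) := by
  classical
  obtain ⟨S, hS⟩ := hX.exists_isPathSupport hG hx₀ t
  have hm : ∀ s x, MeasurableSet {ω | X s ω = x} := fun s x =>
    hX.measurable s (MeasurableSet.singleton x)
  have hx : ∀ x, μ {ω | X t ω = x} =
      ∑ p ∈ S, if p t = x then μ {ω | stoppedPath X x₀ t ω = p} else 0 := by
    intro x
    rw [hX.measure_eq_sum hS (hm t x)]
    refine Finset.sum_congr rfl fun p _ => ?_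
    have hpt : ∀ ω, stoppedPath X x₀ t ω = p → X t ω = p t := by
      rintro ω rfl
      simp [stoppedPath]
    split_ifs with h
    · congr 1
      exact Set.inter_eq_left.2 fun ω hω => (hpt ω hω).trans h
    · convert measure_empty (μ := μ)
      exact Set.eq_empty_iff_forall_notMem.2 fun ω hω => h ((hpt ω hω.1).symm.trans hω.2)
  rw [hX.measure_eq_sum hS (hm (t + 1) y)]
  simp only [hx, Finset.sum_mul, ite_mul, zero_mul]
  rw [Finset.sum_comm]
  refine Finset.sum_congr rfl fun p hp => ?_
  rw [hX.measure_stoppedPath_inter (hS.eq_start p hp), Finset.sum_ite_eq, if_pos (hS.mem p hp)]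

theorem isNetworkLaw [IsProbabilityMeasure μ] (hG : IsGrowing Ginf G)
    (hx₀ : x₀ ∈ nonIsolated (G 0)) :
    IsNetworkLaw hG.verts (fun t => edgeCount (G t)) fun t x => (μ {ω | X t ω = x}).toReal where
  sum_eq_one t := by
    rw [← ENNReal.toReal_sum fun x _ => measure_ne_top _ _, ← measure_biUnion_finset]
    · rw [← ENNReal.toReal_one, ← measure_univ (μ := μ)]
      congr 1
      refine measure_congr ?_
      filter_upwards [hX.ae_mem_verts hG hx₀ t] with ω hω
      exact propext ⟨fun _ => trivial, fun _ => Set.mem_biUnion hω rfl⟩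
    · exact fun x _ x' _ hne => Set.disjoint_left.2 fun ω h h' => hne (h.symm.trans h')
    · exact fun x _ => hX.measurable t (MeasurableSet.singleton x)
  eq_zero t x hx := by
    have : μ {ω | X t ω = x} = 0 := by
      refine measure_mono_null ?_ (hX.ae_mem_verts hG hx₀ t)
      rintro ω rfl
      exact hx
    simp [this]
  succ t y := by
    rw [hX.measure_succ hG hx₀,
      ENNReal.toReal_sum fun x _ => ENNReal.mul_ne_top (measure_ne_top _ _) ENNReal.ofReal_ne_top]
    refine Finset.sum_congr rfl fun x hx => ?_
    rw [ENNReal.toReal_mul, ENNReal.toReal_ofReal, stepProb, hG.degree_eq]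
    exact div_nonneg (edgeCount_nonneg _ _ _) (by
      rw [hG.degree_eq]; exact netDeg_nonneg (edgeCount_nonneg _) _)

end IsSimpleRandomWalk

end WalkLaw

end GrowingWalk

/-! ### Strong transience from summable return probabilities -/

theorem proposition1p6 {V E Ω : Type*} [MeasurableSpace V] [DiscreteMeasurableSpace V]
    [MeasurableSpace Ω] (μ : Measure Ω) [IsProbabilityMeasure μ]
    (Ginf : Graph V E) (G : ℕ → Graph V E) (hG : GrowingWalk.IsGrowing Ginf G)
    (x₀ : V) (hx₀ : x₀ ∈ GrowingWalk.nonIsolated (G 0))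
    (X : ℕ → Ω → V) (hX : GrowingWalk.IsSimpleRandomWalk G x₀ μ X)
    (hlazy : GrowingWalk.UniformlyLazy G)
    (hdeg : GrowingWalk.UniformlyBoundedDegrees G)
    (hvol : Summable fun t : ℕ => (GrowingWalk.vol (G (t + 1)))⁻¹)
    (hmix : Summable fun t : ℕ =>
      Real.exp (-∑ u ∈ Finset.Ico ((t + 1) / 2) (t + 1), GrowingWalk.cheeger (G u) ^ 2)) :
    GrowingWalk.StronglyTransient μ X x₀ := by
  classical
  obtain ⟨γ, hγ, -, hlazy⟩ := hlazy
  obtain ⟨Δ, hdeg⟩ := hdeg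
  have hN := hG.isGrowingNetwork hγ.le hlazy hdeg
  -- The hypotheses sum from time 1; including the term at time 0 does not affect summability.
  have hvol' := (summable_nat_add_iff (f := fun t => (GrowingWalk.vol (G t))⁻¹) 1).1 hvol
  simp only [hG.vol_eq] at hvol'
  have hmix' := (summable_nat_add_iff (f := fun t : ℕ =>
    Real.exp (-∑ u ∈ Finset.Ico (t / 2) t, GrowingWalk.cheeger (G u) ^ 2)) 1).1 hmix
  have hsum := hN.summable_law hγ (fun _ _ => ENNReal.toReal_nonneg) (hX.isNetworkLaw hG hx₀)
    (hG.mem_verts.2 hx₀) hvol' hmix'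
  have hm : ∀ t, MeasurableSet {ω | X t ω = x₀} := fun t =>
    hX.measurable t (MeasurableSet.singleton x₀)
  unfold GrowingWalk.StronglyTransient GrowingWalk.visits
  -- Tonelli: the expected number of visits is the sum of the probabilities of being at `x₀`.
  rw [lintegral_tsum fun t => (measurable_const.indicator (hm t)).aemeasurable]
  simp only [lintegral_indicator_const (hm _), one_mul]
  have hof : ∀ t, μ {ω | X t ω = x₀} = ENNReal.ofReal (μ {ω | X t ω = x₀}).toReal := fun t =>
    (ENNReal.ofReal_toReal (measure_ne_top _ _)).symm
  rw [tsum_congr hof, ← ENNReal.ofReal_tsum_of_nonneg (fun _ => ENNReal.toReal_nonneg) hsum]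
  exact ENNReal.ofReal_lt_top
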